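/- Let $\mathbb H^2$ be the hyperbolic plane, with distance $d$ and isometry group $G=\mathrm{Isom}(\mathbb H^2)\cong \mathrm{PGL}(2,\mathbb R)$, and let $\mathfrak g=\mathfrak{sl}(2,\mathbb R)$ carry the Lorentzian inner product $v\cdot w=\tfrac12\operatorname{tr}(vw)$; a vector $v$ is timelike if $v\cdot v<0$. Each $\xi\in\mathfrak g$ is identified with the Killing vector field $z\mapsto \frac{d}{dt}\big|_{t=0}\exp(t\xi)z$ on $\mathbb H^2$, and $G$ acts on vector fields by push-forward. Let $\Gamma$ be a torsion-free group, let $\rho_0:\Gamma\to G$ be injective with discrete image, put $\Sigma=\rho_0(\Gamma)\backslash\mathbb H^2$, and let $u:\Gamma\to\mathfrak g$ be a cocycle, $u(\gamma\delta)=u(\gamma)+\mathrm{Ad}(\rho_0(\gamma))u(\delta)$. Let $X$ be a continuous vector field on $\mathbb H^2$ that is $u$-equivariant, i.e. $X-\rho_0(\gamma)\cdot X=u(\gamma)$ for all $\gamma\in\Gamma$. Suppose that, for some $k<0$, $X$ is $k$-lipschitz: $d'_X(x,y)\le k\,d(x,y)$ for all $x\ne y$, where $d'_X(x,y)=\frac{d}{dt}\big|_{t=0}d(f_t(x),f_t(y))$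 for a family of maps $f_t$ with $f_0=\mathrm{id}$ and $\frac{d}{dt}\big|_{t=0}f_t=X$ (this depends only on $X$). Let $X-\mathfrak g=\{X-\xi:\xi\in\mathfrak g\}$, an affine space on which $\Gamma$ acts, through $\rho_0$, by push-forward of vector fields. Then: 1. The map $\xi\mapsto X-\xi$ is injective, and the action of $\Gamma$ on $X-\mathfrak g$ is the affine action $\gamma\cdot(X-\xi)=X-u(\gamma)-\mathrm{Ad}(\rho_0(\gamma))\xi$. 2. Each $X-\xi$ has a unique zero $\varpi(X-\xi)\in\mathbb H^2$. The map $\varpi:X-\mathfrak g\to\mathbb H^2$ is continuous and $\Gamma$-equivariant, its fibers are affine lines with timelike direction, and it is a locally trivial bundle of affine lines. 3. $\Gamma$ acts properly discontinuously and freely on $X-\mathfrak g$, and $M=\Gamma\backslash(X-\mathfrak g)$ is a complete affine three-manifold: it is Hausdorff and second countable, $X-\mathfrak g$ is three-dimensional, and $X-\mathfrak g\to M$ is a covering map for which any two points with the same image are related by an affine deck transformation. 4. $\varpi$ induces a map $M\to\Sigma$ that is an affine line bundle with total space $M$: its fibers are the images of the timelike fibers of $\varpi$, with their affine structure, and it is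 locally trivial with fiber $\mathbb R$ by trivializations that are affine on each fiber. -/

import Mathlib

open UpperHalfPlane Matrix
open scoped MatrixGroups Topology

noncomputable section

namespace ContractingField

/-! ### The Lie algebra of Killing fields, as Minkowski space -/

/-- The Lie algebra `𝔤 = sl(2, ℝ)` of traceless real `2 × 2` matrices. -/
abbrev LieAlg : Type := LieAlgebra.SpecialLinear.sl (Fin 2) ℝ

/-- The Lorentzian inner product `v · w = ½ tr (v w)` on `𝔤`. -/
def lorentz (v w : LieAlg) : ℝ := (1 / 2) * ((v : Matrix (Fin 2) (Fin 2) ℝ) * w.1).trace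

/-- A vector is timelike if `v · v < 0`. -/
def Timelike (v : LieAlg) : Prop := lorentz v v < 0

/-- The adjoint action of `GL(2, ℝ)` on `𝔤` by conjugation. -/
def adGL : GL (Fin 2) ℝ →* Module.End ℝ LieAlg where
  toFun g :=
    { toFun := fun A => ⟨g.1 * A.1 * (g⁻¹).1, by
        have h : A.1.trace = 0 := A.2
        change (g.1 * A.1 * (g⁻¹).1).trace = 0
        rw [Matrix.trace_mul_comm, ← Matrix.mul_assoc, Units.inv_mul, Matrix.one_mul, h]⟩
      map_add' := fun A B => Subtype.ext (by simp [Matrix.mul_add, Matrix.add_mul])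
      map_smul' := fun c A => Subtype.ext (by simp) }
  map_one' := by ext A; simp
  map_mul' g h := LinearMap.ext fun A => Subtype.ext (by simp [Matrix.mul_assoc])

/-- The adjoint representation of `G = PGL(2, ℝ)`, the full isometry group of the hyperbolic
plane, on its Lie algebra `𝔤`. -/
def Ad : PGL(2, ℝ) →* Module.End ℝ LieAlg :=
  Matrix.ProjGenLinGroup.lift adGL (by
    refine MonoidHom.ext fun c => LinearMap.ext fun A => Subtype.ext ?_
    have h : (Matrix.scalar (Fin 2) (c : ℝ)) * A.1 = A.1 * Matrix.scalar (Fin 2) (c : ℝ) :=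
      Matrix.scalar_commute _ (fun _ => Commute.all _ _) _
    change (GeneralLinearGroup.scalar (Fin 2) c).1 * A.1 *
      ((GeneralLinearGroup.scalar (Fin 2) c)⁻¹).1 = A.1
    have h' : (GeneralLinearGroup.scalar (Fin 2) c).1 * A.1
        = A.1 * (GeneralLinearGroup.scalar (Fin 2) c).1 := h
    rw [h', Matrix.mul_assoc, Units.mul_inv, Matrix.mul_one])

/-- `PGL(2, ℝ)` with the quotient topology from `GL(2, ℝ)`. -/
instance : TopologicalSpace PGL(2, ℝ) :=
  TopologicalSpace.coinduced Matrix.ProjGenLinGroup.mk inferInstance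

/-- `ρ₀` is a discrete embedding: injective, with discrete image. -/
def IsDiscreteEmbedding {Γ : Type*} [Group Γ] (ρ₀ : Γ →* PGL(2, ℝ)) : Prop :=
  Function.Injective ρ₀ ∧ IsDiscrete (ρ₀.range : Set PGL(2, ℝ))

/-! ### Vector fields on the hyperbolic plane

The hyperbolic plane is the upper half-plane `ℍ ⊆ ℂ` with its hyperbolic distance; a vector field
is a function `X : ℍ → ℂ`. -/

/-- The Killing field of `A ∈ 𝔤`: its value at `z` is `d/dt (exp (t A) • z)` at `t = 0`. -/
def killing (A : LieAlg) : ℍ → ℂ := fun z =>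
  (A.1 0 1 : ℂ) + ((A.1 0 0 : ℂ) - (A.1 1 1 : ℂ)) * z - (A.1 1 0 : ℂ) * (z : ℂ) ^ 2

/-- The action of `G` on vector fields: `(g · Y)(z) = D_{g⁻¹ z} g (Y (g⁻¹ z))`. -/
def push (g : PGL(2, ℝ)) (Y : ℍ → ℂ) : ℍ → ℂ := fun z =>
  fderiv ℝ (fun w : ℂ => ((g • ofComplex w : ℍ) : ℂ)) ((g⁻¹ • z : ℍ) : ℂ) (Y (g⁻¹ • z))

/-- The path of maps `f_t (z) = z + t X(z)`, with `f_0 = id` and initial velocity `X`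
(it takes values in `ℍ` for `t` near `0`, depending on `z`). -/
def flow (X : ℍ → ℂ) (t : ℝ) (z : ℍ) : ℍ := ofComplex ((z : ℂ) + t * X z)

/-- `d'_X(x, y)`, the derivative at `t = 0` of `d(f_t(x), f_t(y))`: the rate at which `X` pushes
`x` and `y` apart. By `hasDerivAt_dist_rate` below it depends only on `X`, not on the path of
maps `f_t`. -/
def rate (X : ℍ → ℂ) (x y : ℍ) : ℝ := deriv (fun t : ℝ => dist (flow X t x) (flow X t y)) 0

/-- `X` is `k`-lipschitz: `d'_X(x, y) ≤ k d(x, y)` for all `x ≠ y`. -/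
def IsLipschitzField (k : ℝ) (X : ℍ → ℂ) : Prop := ∀ x y : ℍ, x ≠ y → rate X x y ≤ k * dist x y

/-! ### Cocycles, equivariant fields and the affine action -/

/-- A deformation cocycle `u ∈ Z¹(Γ, 𝔤_{Ad ρ₀})`. -/
structure Cocycle {Γ : Type*} [Group Γ] (ρ₀ : Γ →* PGL(2, ℝ)) where
  /-- the underlying map -/
  toFun : Γ → LieAlg
  map_mul : ∀ γ δ : Γ, toFun (γ * δ) = toFun γ + Ad (ρ₀ γ) (toFun δ)

/-- `X` is `u`-equivariant: `X - ρ₀(γ) · X` is the Killing field of `u(γ)`, for every `γ`. -/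
def IsEquivariantField {Γ : Type*} [Group Γ] {ρ₀ : Γ →* PGL(2, ℝ)} (u : Cocycle ρ₀)
    (X : ℍ → ℂ) : Prop :=
  ∀ γ : Γ, X - push (ρ₀ γ) X = killing (u.toFun γ)

/-- The hyperbolic plane, as a `Γ`-space through `ρ₀`. -/
def Hyp {Γ : Type*} [Group Γ] (_ρ₀ : Γ →* PGL(2, ℝ)) : Type := ℍ

/-- The affine space `X - 𝔤`, parametrized by `ξ ↦ X - ξ` with `ξ ∈ 𝔤`; it carries the affine
action of `Γ` determined by `ρ₀` and `u`. -/
def Coset {Γ : Type*} [Group Γ] {ρ₀ : Γ →* PGL(2, ℝ)} (_u : Cocycle ρ₀) : Type := LieAlg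

/-- The underlying point of `ℍ`. -/
def Hyp.pt {Γ : Type*} [Group Γ] {ρ₀ : Γ →* PGL(2, ℝ)} (p : Hyp ρ₀) : ℍ := p

section Spaces

variable {Γ : Type*} [Group Γ] {ρ₀ : Γ →* PGL(2, ℝ)} (u : Cocycle ρ₀)

instance : TopologicalSpace (Hyp ρ₀) := inferInstanceAs (TopologicalSpace ℍ)

instance : MulAction Γ (Hyp ρ₀) := MulAction.compHom ℍ ρ₀

instance : TopologicalSpace (Coset u) := inferInstanceAs (TopologicalSpace LieAlg)

instance : AddTorsor LieAlg (Coset u) := inferInstanceAs (AddTorsor LieAlg LieAlg)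

/-- The parameter `ξ ∈ 𝔤` of the point `X - ξ`. -/
def Coset.param {u : Cocycle ρ₀} (P : Coset u) : LieAlg := P

/-- The point `X - ξ` as a vector field on `ℍ`. -/
def Coset.field {u : Cocycle ρ₀} (X : ℍ → ℂ) (P : Coset u) : ℍ → ℂ := X - killing P.param

theorem Cocycle.map_one : u.toFun 1 = 0 := by
  have h := u.map_mul 1 1
  rw [mul_one, _root_.map_one, _root_.map_one, Module.End.one_apply] at h
  simpa using h

/-- The affine action: `γ` sends `X - ξ` to `X - u(γ) - Ad(ρ₀(γ)) ξ`. -/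
instance : MulAction Γ (Coset u) where
  smul γ P := (u.toFun γ + Ad (ρ₀ γ) P.param : LieAlg)
  one_smul P := by
    change (u.toFun 1 + Ad (ρ₀ 1) P.param : LieAlg) = P.param
    rw [u.map_one, _root_.map_one, _root_.map_one, zero_add]
    rfl
  mul_smul γ δ P := by
    change (u.toFun (γ * δ) + Ad (ρ₀ (γ * δ)) P.param : LieAlg) =
      u.toFun γ + Ad (ρ₀ γ) (u.toFun δ + Ad (ρ₀ δ) P.param)
    rw [u.map_mul, _root_.map_mul, _root_.map_mul, map_add, add_assoc]
    rfl

/-- The hyperbolic surface `Σ = ρ₀(Γ) \ ℍ`. -/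
abbrev Surface (ρ₀ : Γ →* PGL(2, ℝ)) : Type := Quotient (MulAction.orbitRel Γ (Hyp ρ₀))

/-- The quotient `M = Γ \ (X - 𝔤)`. -/
abbrev Spacetime : Type := Quotient (MulAction.orbitRel Γ (Coset u))

/-- The affinely parametrized timelike lines of `X - 𝔤` on which `ϖ` is constant. -/
def fiberLines {u : Cocycle ρ₀} (ϖ : Coset u → Hyp ρ₀) : Set (ℝ → Coset u) :=
  {c | ∃ (P : Coset u) (η : LieAlg), Timelike η ∧ (∀ s, c s = (s • η) +ᵥ P) ∧ ∀ s, ϖ (c s) = ϖ P}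

end Spaces

/-! ### Affine line bundles and complete affine manifolds -/

/-- `π : E → B` is an affine line bundle, where `L` is the set of affine parametrizations
`ℝ → E` of its fibers: each member of `L` is a bijection of `ℝ` onto a fiber, every fiber is so
parametrized, any two parametrizations of the same fiber differ by an affine bijection of `ℝ`
(so each fiber is an affine line), and near every point of `B` there is a
local trivialization with fiber `ℝ` that is affine on each fiber. -/
structure IsAffineLineBundle {B E : Type*} [TopologicalSpace B] [TopologicalSpace E]
    (π : E → B) (L : Set (ℝ → E)) : Prop where
  injective : ∀ c ∈ L, Function.Injective c
  range_eq : ∀ c ∈ L, Set.range c = π ⁻¹' {π (c 0)}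
  exists_line : ∀ b : B, ∃ c ∈ L, Set.range c = π ⁻¹' {b}
  change : ∀ c ∈ L, ∀ c' ∈ L, π (c 0) = π (c' 0) →
    ∃ a d : ℝ, a ≠ 0 ∧ ∀ s, c' s = c (a * s + d)
  trivialization : ∀ b : B, ∃ e : Bundle.Trivialization ℝ π, b ∈ e.baseSet ∧
    ∀ c ∈ L, π (c 0) ∈ e.baseSet → ∃ a d : ℝ, a ≠ 0 ∧ ∀ s, (e (c s)).2 = a * s + d

/-- `p : E → M` presents `M` as a complete affine three-manifold, for the affine structure
induced from the affine space `E`: `E` has dimension three, `M` is Hausdorff and second countable,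
`p` is a surjective covering map, and any two points of `E` over the same point
of `M` are related by an affine deck transformation (so the local inverses of `p` are an atlas of
`M` whose transition maps are restrictions of affine maps). -/
structure IsCompleteAffineThreeManifold (V : Type*) {E M : Type*} [AddCommGroup V] [Module ℝ V]
    [AddTorsor V E] [TopologicalSpace E] [TopologicalSpace M] (p : E → M) : Prop where
  finrank_eq : Module.finrank ℝ V = 3
  t2 : T2Space M
  secondCountable : SecondCountableTopology M
  covering : IsCoveringMap p
  surjective : Function.Surjective p
  deck : ∀ x y : E, p x = p y → ∃ T : E ≃ᵃ[ℝ] E, T x = y ∧ ∀ z, p (T z) = p z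

/-! ### The rate does not depend on the chosen path of maps -/

theorem differentiableAt_dist_formula (x y : ℍ) (hxy : x ≠ y) :
    DifferentiableAt ℝ (fun p : ℂ × ℂ =>
      2 * Real.arsinh (‖p.1 - p.2‖ / (2 * √(p.1.im * p.2.im)))) ((x : ℂ), (y : ℂ)) := by
  have h1 : ((x : ℂ) - (y : ℂ)) ≠ 0 := sub_ne_zero.2 (fun h => hxy (UpperHalfPlane.ext h))
  have h2 : (x : ℂ).im * (y : ℂ).im ≠ 0 := (mul_pos x.im_pos y.im_pos).ne'
  have h3 : √((x : ℂ).im * (y : ℂ).im) ≠ 0 :=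
    (Real.sqrt_pos.2 (mul_pos x.im_pos y.im_pos)).ne'
  have e1 : DifferentiableAt ℝ (fun p : ℂ × ℂ => ‖p.1 - p.2‖) ((x : ℂ), (y : ℂ)) :=
    DifferentiableAt.norm ℝ (differentiableAt_fst.sub differentiableAt_snd) h1
  have i1 : DifferentiableAt ℝ (fun p : ℂ × ℂ => p.1.im) ((x : ℂ), (y : ℂ)) :=
    Complex.imCLM.differentiableAt.comp _ differentiableAt_fst
  have i2 : DifferentiableAt ℝ (fun p : ℂ × ℂ => p.2.im) ((x : ℂ), (y : ℂ)) :=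
    Complex.imCLM.differentiableAt.comp _ differentiableAt_snd
  have e2 : DifferentiableAt ℝ (fun p : ℂ × ℂ => √(p.1.im * p.2.im)) ((x : ℂ), (y : ℂ)) :=
    (i1.mul i2).sqrt h2
  simp only [div_eq_mul_inv]
  exact ((e1.mul ((e2.const_mul 2).fun_inv (mul_ne_zero two_ne_zero h3))).arsinh).const_mul 2

/-- If `a`, `b` are any curves in `ℍ` starting at `x ≠ y` with velocities `X(x)` and `X(y)`, then
`d(a(t), b(t))` has derivative `rate X x y` at `t = 0`. -/
theorem hasDerivAt_dist_rate (X : ℍ → ℂ) (x y : ℍ) (hxy : x ≠ y) (a b : ℝ → ℍ)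
    (ha0 : a 0 = x) (hb0 : b 0 = y) (ha : HasDerivAt (fun t => (a t : ℂ)) (X x) 0)
    (hb : HasDerivAt (fun t => (b t : ℂ)) (X y) 0) :
    HasDerivAt (fun t => dist (a t) (b t)) (rate X x y) 0 := by
  have key : ∀ (a b : ℝ → ℍ), a 0 = x → b 0 = y → HasDerivAt (fun t => (a t : ℂ)) (X x) 0 →
      HasDerivAt (fun t => (b t : ℂ)) (X y) 0 →
      HasDerivAt (fun t => dist (a t) (b t)) (fderiv ℝ (fun p : ℂ × ℂ =>
        2 * Real.arsinh (‖p.1 - p.2‖ / (2 * √(p.1.im * p.2.im)))) ((x : ℂ), (y : ℂ))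
          (X x, X y)) 0 := by
    intro a b ha0 hb0 ha hb
    have h := (differentiableAt_dist_formula x y hxy).hasFDerivAt
    have hp : HasDerivAt (fun t => ((a t : ℂ), (b t : ℂ))) (X x, X y) 0 := ha.prodMk hb
    rw [← ha0, ← hb0] at h
    have := h.comp_hasDerivAt (0 : ℝ) hp
    rw [ha0, hb0] at this
    refine this.congr_of_eventuallyEq (Filter.Eventually.of_forall fun t => ?_)
    simp only [UpperHalfPlane.dist_eq, Function.comp, Complex.dist_eq]
    rfl
  have hflow : ∀ z : ℍ, HasDerivAt (fun t => (flow X t z : ℂ)) (X z) 0 := by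
    intro z
    have h : HasDerivAt (fun t : ℝ => (z : ℂ) + t * X z) (X z) 0 := by
      simpa using ((Complex.ofRealCLM.hasDerivAt (x := (0 : ℝ))).mul_const (X z)).const_add (z : ℂ)
    refine h.congr_of_eventuallyEq ?_
    have hc : Filter.Tendsto (fun t : ℝ => ((z : ℂ) + t * X z).im) (𝓝 0) (𝓝 z.im) := by
      have h' : Continuous fun t : ℝ => ((z : ℂ) + t * X z).im := by fun_prop
      simpa using h'.tendsto 0
    filter_upwards [hc.eventually (lt_mem_nhds z.im_pos)] with t ht
    rw [flow, ofComplex_apply_of_im_pos ht]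
  have h0 : ∀ z : ℍ, flow X 0 z = z := fun z => by simp [flow, ofComplex_apply]
  have h1 := key a b ha0 hb0 ha hb
  have h2 := key (fun t => flow X t x) (fun t => flow X t y) (h0 x) (h0 y) (hflow x) (hflow y)
  rw [rate, h2.deriv]
  exact h1

end ContractingField

end

noncomputable section

namespace ContractingField

/-! A Killing field changes no distance to first order, so every `X - ξ` contracts at the same rate
`k < 0` as `X` (`rate_sub_killing`). If such a field `Y` vanishes at `y`, comparing the rate at `x,
y` with the size of `Y x` gives `-k * dist x y ≤ ‖Y x‖ / x.im` (`IsLipschitzField.mul_dist_le`).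
This yields uniqueness of the zero, and continuity of `ϖ` because `X - ξ` at a fixed point depends
continuously on `ξ`.

Existence is an index argument. On a large circle about `I`, contraction outweighs the bounded
contribution of `Y I`, so `Y` points strictly inward. A field without zeros has a continuous
argument on the simply connected plane, which cannot follow the full turn of the normal
(`exists_re_exp_mul_nonneg`).

The field `X - ξ` vanishes at `z` exactly when `ξ` has value `X z` there. The solutions form a coset
of the line of infinitesimal rotations about `z`, which is timelike. Since a timelike vector has
nonzero lower left entry, that entry is an affine coordinate on each fiber, and with `ϖ` it
identifies `X - 𝔤` with `ℍ × ℝ` (`zeroChart`).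

Equivariance of `ϖ` pulls proper discontinuity back from `ℍ`, and absence of torsion makes both
actions free. The line bundle therefore descends to the quotients (`IsAffineLineBundle.quotient`).
-/

/-! ### Coordinates on traceless matrices and Killing fields -/

theorem LieAlg.apply_one_one (A : LieAlg) : A.1 1 1 = -A.1 0 0 := by
  have h : A.1.trace = 0 := A.2
  rw [Matrix.trace_fin_two] at h
  linarith

theorem LieAlg.ext_entries {A B : LieAlg} (h00 : A.1 0 0 = B.1 0 0) (h01 : A.1 0 1 = B.1 0 1)
    (h10 : A.1 1 0 = B.1 1 0) : A = B := by
  refine Subtype.ext (Matrix.ext fun i j => ?_)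
  fin_cases i <;> fin_cases j
  · exact h00
  · exact h01
  · exact h10
  · exact (LieAlg.apply_one_one A).trans ((congrArg _ h00).trans (LieAlg.apply_one_one B).symm)

/-- The traceless matrix `!![a, b; c, -a]`. -/
def LieAlg.of (a b c : ℝ) : LieAlg :=
  ⟨!![a, b; c, -a], by
    change Matrix.trace (!![a, b; c, -a] : Matrix (Fin 2) (Fin 2) ℝ) = 0
    simp [Matrix.trace_fin_two]⟩

/-- The coordinates `(a, b, c)` of the traceless matrix `!![a, b; c, -a]`. -/
def LieAlg.coords : LieAlg ≃ₗ[ℝ] (Fin 3 → ℝ) where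
  toFun A := ![A.1 0 0, A.1 0 1, A.1 1 0]
  map_add' A B := by ext i; fin_cases i <;> rfl
  map_smul' c A := by ext i; fin_cases i <;> rfl
  invFun v := LieAlg.of (v 0) (v 1) (v 2)
  left_inv A := LieAlg.ext_entries rfl rfl rfl
  right_inv v := by ext i; fin_cases i <;> rfl

theorem LieAlg.finrank_eq : Module.finrank ℝ LieAlg = 3 := by
  simpa using LieAlg.coords.finrank_eq

theorem LieAlg.continuous_entry (i j : Fin 2) : Continuous fun A : LieAlg => A.1 i j :=
  (continuous_apply_apply i j).comp continuous_subtype_val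

/-- `LieAlg.coords` as a homeomorphism. -/
def LieAlg.coordsHomeomorph : LieAlg ≃ₜ (Fin 3 → ℝ) where
  toEquiv := LieAlg.coords.toEquiv
  continuous_toFun := by
    refine continuous_pi fun i => ?_
    fin_cases i
    · exact LieAlg.continuous_entry 0 0
    · exact LieAlg.continuous_entry 0 1
    · exact LieAlg.continuous_entry 1 0
  continuous_invFun := by
    refine Continuous.subtype_mk (continuous_matrix fun i j => ?_) _
    fin_cases i <;> fin_cases j
    · exact continuous_apply 0
    · exact continuous_apply 1
    · exact continuous_apply 2
    · exact (continuous_apply 0).neg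

theorem killing_eq (A : LieAlg) (z : ℍ) :
    killing A z = A.1 0 1 + 2 * A.1 0 0 * z - A.1 1 0 * (z : ℂ) ^ 2 := by
  rw [killing, LieAlg.apply_one_one]
  push_cast
  ring

theorem killing_add (A B : LieAlg) : killing (A + B) = killing A + killing B := by
  ext z
  have h : ∀ i j, (A + B).1 i j = A.1 i j + B.1 i j := fun i j => rfl
  simp only [killing_eq, h, Pi.add_apply]
  push_cast
  ring

theorem killing_sub (A B : LieAlg) : killing (A - B) = killing A - killing B := by
  rw [eq_sub_iff_add_eq, ← killing_add, sub_add_cancel]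

theorem continuous_killing (A : LieAlg) : Continuous (killing A) := by
  unfold killing
  fun_prop

/-- A Killing field vanishes at `z` iff it is infinitesimal rotation about `z`. -/
theorem killing_apply_eq_zero_iff (A : LieAlg) (z : ℍ) :
    killing A z = 0 ↔ A.1 0 0 = A.1 1 0 * z.re ∧ A.1 0 1 = -(A.1 1 0 * (z.re ^ 2 + z.im ^ 2)) := by
  have hy := z.im_pos
  rw [killing_eq, Complex.ext_iff]
  simp only [pow_two, Complex.add_re, Complex.sub_re, Complex.mul_re, Complex.ofReal_re,
    Complex.ofReal_im, Complex.add_im, Complex.sub_im, Complex.mul_im, Complex.re_ofNat,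
    Complex.im_ofNat, Complex.zero_re, Complex.zero_im, coe_re, coe_im]
  constructor
  · rintro ⟨h1, h2⟩
    have h3 : A.1 0 0 = A.1 1 0 * z.re := by
      apply mul_left_cancel₀ hy.ne'
      linarith
    refine ⟨h3, ?_⟩
    rw [h3] at h1
    linarith
  · rintro ⟨h1, h2⟩
    rw [h1, h2]
    constructor <;> ring

/-- A nonzero infinitesimal rotation has only one center, so vanishing at the two points `I` and `1
+ I` already forces the matrix to be zero. -/
theorem killing_injective : Function.Injective killing := by
  intro A B h
  have h0 : ∀ z, killing (A - B) z = 0 := fun z => by rw [killing_sub, h, sub_self, Pi.zero_apply]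
  have e : ∀ i j, (A - B).1 i j = A.1 i j - B.1 i j := fun i j => rfl
  simp only [killing_apply_eq_zero_iff, e] at h0
  have h1 := (h0 UpperHalfPlane.I).1
  have h2 := (h0 UpperHalfPlane.I).2
  have h3 := (h0 ⟨1 + Complex.I, by simp⟩).1
  simp at h1 h2 h3
  exact LieAlg.ext_entries (by linarith) (by linarith) (by linarith)

/-! ### Push-forward of vector fields -/

theorem hasDerivAt_moebius (g : GL (Fin 2) ℝ) (z : ℍ) :
    HasDerivAt (fun w : ℂ => num g w / denom g w) ((g.1.det : ℂ) / denom g z ^ 2) z := by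
  have h1 : HasDerivAt (num g) (g 0 0 : ℂ) z :=
    ((hasDerivAt_const_mul (g 0 0 : ℂ)).add_const (g 0 1 : ℂ))
  have h2 : HasDerivAt (denom g) (g 1 0 : ℂ) z :=
    ((hasDerivAt_const_mul (g 1 0 : ℂ)).add_const (g 1 1 : ℂ))
  convert! h1.div h2 (denom_ne_zero g z) using 2
  rw [Matrix.det_fin_two]
  simp only [num, denom]
  push_cast
  ring

/-- Elements of negative determinant act antiholomorphically. The derivative is thus only real
linear: the complex Möbius derivative followed by `σ g`, which is the identity or conjugation. -/
theorem fderiv_smul_apply (g : GL (Fin 2) ℝ) (z : ℍ) (v : ℂ) :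
    fderiv ℝ (fun w : ℂ => ((ProjGenLinGroup.mk g • ofComplex w : ℍ) : ℂ)) z v =
      σ g ((g.1.det : ℂ) / denom g z ^ 2 * v) := by
  have h := (σ g).toContinuousLinearEquiv.toContinuousLinearMap.hasFDerivAt.comp (z : ℂ)
    ((hasDerivAt_moebius g z).hasFDerivAt.restrictScalars ℝ)
  have h' : HasFDerivAt (fun w : ℂ => ((ProjGenLinGroup.mk g • ofComplex w : ℍ) : ℂ)) _ (z : ℂ) :=
    h.congr_of_eventuallyEq (by
      filter_upwards [(isOpen_lt continuous_const Complex.continuous_im).mem_nhds z.im_pos]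
        with w hw
      rw [pglMk_smul, coe_smul, ofComplex_apply_of_im_pos hw]
      rfl)
  rw [h'.fderiv]
  simp [mul_comm]

theorem push_mk (g : GL (Fin 2) ℝ) (Y : ℍ → ℂ) (z : ℍ) :
    push (ProjGenLinGroup.mk g) Y (g • z) = σ g ((g.1.det : ℂ) / denom g z ^ 2 * Y z) := by
  rw [push, ← map_inv, pglMk_smul, inv_smul_smul, fderiv_smul_apply]

theorem push_mk_killing (g : GL (Fin 2) ℝ) (A : LieAlg) :
    push (ProjGenLinGroup.mk g) (killing A) = killing (Ad (ProjGenLinGroup.mk g) A) := by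
  funext z
  obtain ⟨z, rfl⟩ := MulAction.surjective g z
  rw [push_mk]
  set B := Ad (ProjGenLinGroup.mk g) A with hB
  have hBg : B.1 * g.1 = g.1 * A.1 := by
    change g.1 * A.1 * (g⁻¹).1 * g.1 = g.1 * A.1
    rw [Matrix.mul_assoc, Units.inv_mul, Matrix.mul_one]
  have e : ∀ i j, (B.1 i 0 : ℂ) * g.1 0 j + B.1 i 1 * g.1 1 j =
      g.1 i 0 * A.1 0 j + g.1 i 1 * A.1 1 j := fun i j => by
    have := congrFun (congrFun hBg i) j
    simp only [Matrix.mul_apply, Fin.sum_univ_two] at this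
    exact_mod_cast this
  -- With `v = (z, 1)`, the Killing field is the determinant of the columns `A v, v`. As `g v =
  -- (num, denom)` and `g A = B g`, multiplying by `det g` gives the determinant of `B (g v), g v`.
  have key : (g.1.det : ℂ) * killing A z = B.1 0 1 * denom g z ^ 2 +
      (B.1 0 0 - B.1 1 1) * num g z * denom g z - B.1 1 0 * num g z ^ 2 := by
    rw [Matrix.det_fin_two, killing]
    simp only [num, denom]
    push_cast
    linear_combination (-(g.1 1 0 * (z : ℂ) + g.1 1 1)) * (z * e 0 0 + e 0 1) +
      (g.1 0 0 * (z : ℂ) + g.1 0 1) * (z * e 1 0 + e 1 1)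
  have hd := denom_ne_zero g z
  have : killing B (g • z) = σ g (B.1 0 1 + (B.1 0 0 - B.1 1 1) * (num g z / denom g z)
      - B.1 1 0 * (num g z / denom g z) ^ 2) := by
    rw [killing, coe_smul]
    simp only [map_sub, map_add, map_mul, map_pow, σ_ofReal]
  rw [this]
  congr 1
  field_simp
  linear_combination key

theorem push_killing (g : PGL(2, ℝ)) (A : LieAlg) : push g (killing A) = killing (Ad g A) := by
  induction g using ProjGenLinGroup.induction_on with | mk g => exact push_mk_killing g A

theorem push_sub (g : PGL(2, ℝ)) (Y Z : ℍ → ℂ) : push g (Y - Z) = push g Y - push g Z := by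
  funext z
  exact map_sub _ _ _

theorem push_smul_eq_zero (g : PGL(2, ℝ)) (Y : ℍ → ℂ) (z : ℍ) (h : Y z = 0) :
    push g Y (g • z) = 0 := by
  rw [push, inv_smul_smul, h, map_zero]

/-! ### The Lorentzian form and infinitesimal rotations -/

theorem lorentz_Ad (g : PGL(2, ℝ)) (v w : LieAlg) : lorentz (Ad g v) (Ad g w) = lorentz v w := by
  induction g using ProjGenLinGroup.induction_on with
  | mk g =>
    change (1 / 2) * ((g.1 * v.1 * (g⁻¹).1) * (g.1 * w.1 * (g⁻¹).1)).trace = _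
    rw [lorentz]
    congr 1
    rw [show (g.1 * v.1 * (g⁻¹).1) * (g.1 * w.1 * (g⁻¹).1) =
        g.1 * (v.1 * ((g⁻¹).1 * g.1) * w.1) * (g⁻¹).1 by simp only [Matrix.mul_assoc],
      Units.inv_mul, Matrix.mul_one, Matrix.trace_mul_comm, ← Matrix.mul_assoc, Units.inv_mul,
      Matrix.one_mul]

theorem lorentz_self (v : LieAlg) : lorentz v v = v.1 0 0 ^ 2 + v.1 0 1 * v.1 1 0 := by
  rw [lorentz, Matrix.trace_fin_two]
  simp only [Matrix.mul_apply, Fin.sum_univ_two, LieAlg.apply_one_one]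
  ring

theorem Timelike.ne_zero {v : LieAlg} (h : Timelike v) : v.1 1 0 ≠ 0 := by
  intro h0
  rw [Timelike, lorentz_self, h0, mul_zero, add_zero] at h
  exact absurd h (not_lt.2 (sq_nonneg _))

/-- The infinitesimal rotation about `z`, normalized to have lower left entry `1`. -/
def rotation (z : ℍ) : LieAlg := LieAlg.of z.re (-(z.re ^ 2 + z.im ^ 2)) 1

theorem timelike_rotation (z : ℍ) : Timelike (rotation z) := by
  have h : lorentz (rotation z) (rotation z) = -z.im ^ 2 := by
    rw [lorentz_self]
    simp [rotation, LieAlg.of]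
  rw [Timelike, h]
  have := z.im_pos
  nlinarith

theorem killing_eq_zero_iff_smul_rotation (A : LieAlg) (z : ℍ) :
    killing A z = 0 ↔ A = A.1 1 0 • rotation z := by
  rw [killing_apply_eq_zero_iff]
  have e : ∀ i j, (A.1 1 0 • rotation z).1 i j = A.1 1 0 * (rotation z).1 i j := fun i j => rfl
  constructor
  · rintro ⟨h1, h2⟩
    refine LieAlg.ext_entries ?_ ?_ ?_ <;> rw [e]
    · simpa [rotation, LieAlg.of] using h1
    · simp only [rotation, LieAlg.of, Matrix.of_apply, Matrix.cons_val_zero, Matrix.cons_val_one,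
        Matrix.cons_val', Matrix.cons_val_fin_one]
      linarith
    · simp [rotation, LieAlg.of]
  · intro h
    constructor
    · conv_lhs => rw [h, e]
      simp [rotation, LieAlg.of]
    · conv_lhs => rw [h, e]
      simp [rotation, LieAlg.of]
      ring

/-- The element of `𝔤` with lower left entry `0` whose Killing field takes the value `v` at `z`. -/
def killingLift (z : ℍ) (v : ℂ) : LieAlg :=
  LieAlg.of (v.im / (2 * z.im)) (v.re - v.im / z.im * z.re) 0

theorem killing_killingLift (z : ℍ) (v : ℂ) : killing (killingLift z v) z = v := by
  have hy := z.im_ne_zero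
  obtain ⟨a, ha⟩ : ∃ a : ℝ, a = v.im / (2 * z.im) := ⟨_, rfl⟩
  have h : v.im = 2 * a * z.im := by rw [ha]; field_simp
  have h' : v.im / z.im = 2 * a := by rw [ha]; field_simp
  rw [killing_eq, killingLift, ← ha, h']
  apply Complex.ext
  · simp [LieAlg.of]
  · simp [LieAlg.of, h]

/-! ### First variation of distance and contraction -/

/-- The contribution of a velocity `v` at `x` to `sinh d(x, y)` times the derivative of
`d(x, y)`. -/
def pull (x y : ℍ) (v : ℂ) : ℝ :=
  (2 * x.im * ((x.re - y.re) * v.re + (x.im - y.im) * v.im) -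
    ((x.re - y.re) ^ 2 + (x.im - y.im) ^ 2) * v.im) / (2 * x.im ^ 2 * y.im)

theorem dist_coe_sq (x y : ℍ) :
    dist (x : ℂ) y ^ 2 = (x.re - y.re) ^ 2 + (x.im - y.im) ^ 2 := by
  rw [Complex.dist_eq, ← Complex.normSq_eq_norm_sq, Complex.normSq_apply]
  simp only [Complex.sub_re, Complex.sub_im, coe_re, coe_im]
  ring

theorem cosh_dist_formula (x y : ℍ) : Real.cosh (dist x y) =
    1 + ((x.re - y.re) ^ 2 + (x.im - y.im) ^ 2) / (2 * x.im * y.im) := by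
  rw [cosh_dist, dist_coe_sq]

theorem hasDerivAt_flow (X : ℍ → ℂ) (z : ℍ) :
    HasDerivAt (fun t => (flow X t z : ℂ)) (X z) 0 := by
  have h : HasDerivAt (fun t : ℝ => (z : ℂ) + t * X z) (X z) 0 := by
    simpa using ((Complex.ofRealCLM.hasDerivAt (x := (0 : ℝ))).mul_const (X z)).const_add (z : ℂ)
  refine h.congr_of_eventuallyEq ?_
  have hc : Filter.Tendsto (fun t : ℝ => ((z : ℂ) + t * X z).im) (𝓝 0) (𝓝 z.im) := by
    have h' : Continuous fun t : ℝ => ((z : ℂ) + t * X z).im := by fun_prop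
    simpa using h'.tendsto 0
  filter_upwards [hc.eventually (lt_mem_nhds z.im_pos)] with t ht
  rw [flow, ofComplex_apply_of_im_pos ht]

theorem flow_zero (X : ℍ → ℂ) (z : ℍ) : flow X 0 z = z := by simp [flow, ofComplex_apply]

/-- The derivative is taken of `cosh d`, a rational function of the coordinates; the factor `sinh d`
comes from the chain rule. -/
theorem sinh_dist_mul_rate (X : ℍ → ℂ) (x y : ℍ) (hxy : x ≠ y) :
    Real.sinh (dist x y) * rate X x y = pull x y (X x) + pull y x (X y) := by
  have hx := hasDerivAt_flow X x
  have hy := hasDerivAt_flow X y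
  have h1 := (hasDerivAt_dist_rate X x y hxy _ _ (flow_zero X x) (flow_zero X y) hx hy).cosh
  rw [flow_zero, flow_zero] at h1
  have xr : HasDerivAt (fun t => (flow X t x).re) (X x).re 0 :=
    Complex.reCLM.hasFDerivAt.comp_hasDerivAt 0 hx
  have xi : HasDerivAt (fun t => (flow X t x).im) (X x).im 0 :=
    Complex.imCLM.hasFDerivAt.comp_hasDerivAt 0 hx
  have yr : HasDerivAt (fun t => (flow X t y).re) (X y).re 0 :=
    Complex.reCLM.hasFDerivAt.comp_hasDerivAt 0 hy
  have yi : HasDerivAt (fun t => (flow X t y).im) (X y).im 0 :=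
    Complex.imCLM.hasFDerivAt.comp_hasDerivAt 0 hy
  have h2 := ((((xr.fun_sub yr).fun_pow 2).fun_add ((xi.fun_sub yi).fun_pow 2)).fun_div
    ((xi.const_mul 2).fun_mul yi)
    (by simp [im_ne_zero])).const_add 1
  simp only [cosh_dist_formula] at h1
  rw [h1.unique h2]
  simp only [flow_zero, pull]
  have := x.im_ne_zero
  have := y.im_ne_zero
  field_simp
  push_cast
  ring

theorem pull_sub (x y : ℍ) (v w : ℂ) : pull x y (v - w) = pull x y v - pull x y w := by
  simp only [pull, Complex.sub_re, Complex.sub_im]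
  ring

theorem pull_zero (x y : ℍ) : pull x y 0 = 0 := by simp [pull]

theorem pull_killing (A : LieAlg) (x y : ℍ) :
    pull x y (killing A x) + pull y x (killing A y) = 0 := by
  have := x.im_ne_zero
  have := y.im_ne_zero
  have re : ∀ z : ℍ, (killing A z).re =
      A.1 0 1 + 2 * A.1 0 0 * z.re - A.1 1 0 * (z.re ^ 2 - z.im ^ 2) := fun z => by
    rw [killing_eq]
    simp [pow_two]
  have im : ∀ z : ℍ, (killing A z).im =
      2 * A.1 0 0 * z.im - A.1 1 0 * (2 * z.re * z.im) := fun z => by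
    rw [killing_eq]
    simp only [pow_two, Complex.add_im, Complex.sub_im, Complex.mul_re, Complex.mul_im,
      Complex.ofReal_re, Complex.ofReal_im, Complex.re_ofNat, Complex.im_ofNat, coe_re, coe_im]
    ring
  simp only [pull, re, im]
  field_simp
  ring

theorem rate_sub_killing (X : ℍ → ℂ) (A : LieAlg) (x y : ℍ) (hxy : x ≠ y) :
    rate (X - killing A) x y = rate X x y := by
  have hs : Real.sinh (dist x y) ≠ 0 := (Real.sinh_pos_iff.2 (dist_pos.2 hxy)).ne'
  apply mul_left_cancel₀ hs
  rw [sinh_dist_mul_rate _ _ _ hxy, sinh_dist_mul_rate _ _ _ hxy, Pi.sub_apply, Pi.sub_apply,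
    pull_sub, pull_sub]
  linarith [pull_killing A x y]

theorem IsLipschitzField.sub_killing {k : ℝ} {X : ℍ → ℂ} (h : IsLipschitzField k X) (A : LieAlg) :
    IsLipschitzField k (X - killing A) := fun x y hxy => by
  rw [rate_sub_killing X A x y hxy]
  exact h x y hxy

/-- Cauchy–Schwarz: the gradient of the distance has hyperbolic norm one, and `‖v‖ / x.im` is the
hyperbolic norm of `v`. -/
theorem abs_pull_le (x y : ℍ) (v : ℂ) :
    |pull x y v| ≤ ‖v‖ / x.im * Real.sinh (dist x y) := by
  have hx := x.im_pos
  have hy := y.im_pos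
  have hs : 0 ≤ Real.sinh (dist x y) := Real.sinh_nonneg_iff.2 dist_nonneg
  refine abs_le_of_sq_le_sq ?_ (by positivity)
  rw [mul_pow, Real.sinh_sq, cosh_dist_formula, div_pow, ← Complex.normSq_eq_norm_sq,
    Complex.normSq_apply, pull, div_pow]
  rw [← sub_nonneg]
  -- Lagrange's identity: the defect is the square of the component of `v` orthogonal to the
  -- gradient. The other summand vanishes once `b = p - q`.
  have key : ∀ a b p q r s : ℝ, 0 < p → 0 < q →
      (r * r + s * s) / p ^ 2 * ((1 + (a ^ 2 + b ^ 2) / (2 * p * q)) ^ 2 - 1) -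
        (2 * p * (a * r + b * s) - (a ^ 2 + b ^ 2) * s) ^ 2 / (2 * p ^ 2 * q) ^ 2 =
      ((4 * p * q - 4 * p * (p - b) + a ^ 2 + b ^ 2 - (a ^ 2 + b ^ 2)) * (a ^ 2 + b ^ 2)
          * (r ^ 2 + s ^ 2) +
        (2 * p * a * s - (2 * p * b - (a ^ 2 + b ^ 2)) * r) ^ 2) / (2 * p ^ 2 * q) ^ 2 := by
    intro a b p q r s hp hq
    field_simp
    ring
  rw [key _ _ _ _ _ _ hx hy]
  apply div_nonneg _ (sq_nonneg _)
  have : 4 * x.im * y.im - 4 * x.im * (x.im - (x.im - y.im)) + (x.re - y.re) ^ 2 +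
      (x.im - y.im) ^ 2 - ((x.re - y.re) ^ 2 + (x.im - y.im) ^ 2) = 0 := by ring
  rw [this, zero_mul, zero_mul, zero_add]
  exact sq_nonneg _

/-- A contracting field displaces the neighbours of its zeros at a definite speed. -/
theorem IsLipschitzField.mul_dist_le {k : ℝ} {Y : ℍ → ℂ} (h : IsLipschitzField k Y) {x y : ℍ}
    (hy : Y y = 0) : -k * dist x y ≤ ‖Y x‖ / x.im := by
  have hx := x.im_pos
  rcases eq_or_ne x y with rfl | hxy
  · rw [dist_self, mul_zero]
    positivity
  have hs : 0 < Real.sinh (dist x y) := Real.sinh_pos_iff.2 (dist_pos.2 hxy)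
  have h1 := sinh_dist_mul_rate Y x y hxy
  rw [hy, pull_zero, add_zero] at h1
  have h2 := (abs_le.1 (abs_pull_le x y (Y x))).1
  have h3 := mul_le_mul_of_nonneg_left (h x y hxy) hs.le
  have h4 : (-k * dist x y) * Real.sinh (dist x y) ≤ ‖Y x‖ / x.im * Real.sinh (dist x y) := by
    linarith
  exact le_of_mul_le_mul_right h4 hs

theorem IsLipschitzField.eq_of_zero {k : ℝ} (hk : k < 0) {Y : ℍ → ℂ} (h : IsLipschitzField k Y)
    {x y : ℍ} (hx : Y x = 0) (hy : Y y = 0) : x = y := by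
  have h1 := h.mul_dist_le (x := x) hy
  rw [hx, norm_zero, zero_div] at h1
  have : dist x y ≤ 0 := by nlinarith [dist_nonneg (x := x) (y := y)]
  exact dist_le_zero.1 this

/-! ### Existence of a zero -/

/-- A nowhere vanishing field on the plane cannot point inwards all along a circle. -/
theorem exists_re_exp_mul_nonneg {Y : ℍ → ℂ} (hY : Continuous Y) (h0 : ∀ z, Y z ≠ 0)
    {c : ℝ → ℍ} (hc : Continuous c) (hper : c (2 * Real.pi) = c 0) :
    ∃ t : ℝ, 0 ≤ (Complex.exp (-(t * Complex.I)) * Y (c t)).re := by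
  by_contra! hneg
  have hU : IsSimplyConnected (Set.univ : Set ℍ) :=
    (Homeomorph.Set.univ ℍ).toHomotopyEquiv.simplyConnectedSpace
  obtain ⟨f, hf, hfY⟩ := Complex.exists_continuousOn_eqOn_exp_comp hU isOpen_univ hY.continuousOn
    (by rintro ⟨z, -, hz⟩; exact h0 z hz)
  rw [continuousOn_univ] at hf
  have hfc : ∀ z, Complex.exp (f z) = Y z := fun z => hfY (Set.mem_univ z)
  -- `θ` is the angle from the direction `exp (t * I)` to `Y (c t)`; the hypothesis being refuted
  -- says that its cosine is always negative.
  set θ : ℝ → ℝ := fun t => (f (c t)).im - t with hθ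
  have hθc : Continuous θ := (Complex.continuous_im.comp (hf.comp hc)).sub continuous_id
  have hcos : ∀ t, Real.cos (θ t) < 0 := fun t => by
    have h := hneg t
    rw [← hfc, ← Complex.exp_add, Complex.exp_re] at h
    simp only [Complex.add_im, Complex.neg_im, Complex.mul_im, Complex.ofReal_re, Complex.I_im,
      mul_one, Complex.ofReal_im, Complex.I_re, mul_zero, add_zero] at h
    have h' := neg_of_mul_neg_right h (Real.exp_pos _).le
    rwa [show -t + (f (c t)).im = θ t by rw [hθ]; ring] at h'
  have h2π : θ (2 * Real.pi) = θ 0 - 2 * Real.pi := by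
    simp only [hθ, hper]
    ring
  have hpos := Real.two_pi_pos
  -- Over one turn `θ` drops by `2π`, so it passes through a multiple of `2π`, where the cosine is
  -- `1`.
  obtain ⟨n, hn⟩ : ∃ n : ℤ, θ 0 - 2 * Real.pi ≤ n * (2 * Real.pi) ∧
      n * (2 * Real.pi) ≤ θ 0 := by
    refine ⟨⌊θ 0 / (2 * Real.pi)⌋, ?_, ?_⟩
    · have := (Int.lt_floor_add_one (θ 0 / (2 * Real.pi))).le
      rw [div_le_iff₀ hpos] at this
      linarith
    · have := Int.floor_le (θ 0 / (2 * Real.pi))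
      rwa [le_div_iff₀ hpos] at this
  obtain ⟨t, -, ht⟩ := intermediate_value_Icc' hpos.le hθc.continuousOn (by rw [h2π]; exact hn)
  have := hcos t
  rw [ht, Real.cos_int_mul_two_pi] at this
  linarith

/-- The hyperbolic circle of radius `R` about `I`, parametrized as a Euclidean circle. -/
def circle (R t : ℝ) : ℍ :=
  ⟨Real.cosh R * Complex.I + Real.sinh R * Complex.exp (t * Complex.I), by
    simp only [Complex.add_im, Complex.im_ofReal_mul, Complex.I_im, mul_one,
      Complex.exp_ofReal_mul_I_im]
    have h1 := Real.cosh_sq R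
    have h2 := Real.sin_sq_add_cos_sq t
    have h3 := Real.cosh_pos R
    nlinarith [sq_nonneg (Real.sinh R * Real.cos t), sq_nonneg (Real.sinh R * Real.sin t)]⟩

theorem circle_re (R t : ℝ) : (circle R t).re = Real.sinh R * Real.cos t := by
  change (Real.cosh R * Complex.I + Real.sinh R * Complex.exp (t * Complex.I) : ℂ).re = _
  simp only [Complex.add_re, Complex.re_ofReal_mul, Complex.I_re, mul_zero, zero_add,
    Complex.exp_ofReal_mul_I_re]

theorem circle_im (R t : ℝ) : (circle R t).im = Real.cosh R + Real.sinh R * Real.sin t := by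
  change (Real.cosh R * Complex.I + Real.sinh R * Complex.exp (t * Complex.I) : ℂ).im = _
  simp only [Complex.add_im, Complex.im_ofReal_mul, Complex.I_im, mul_one,
    Complex.exp_ofReal_mul_I_im]

theorem dist_circle {R : ℝ} (hR : 0 ≤ R) (t : ℝ) : dist (circle R t) UpperHalfPlane.I = R := by
  have hi := (circle R t).im_pos
  have h : Real.cosh (dist (circle R t) UpperHalfPlane.I) = Real.cosh R := by
    rw [cosh_dist_formula]
    have h1 := Real.cosh_sq R
    have h2 := Real.sin_sq_add_cos_sq t
    rw [circle_im] at hi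
    simp only [circle_re, circle_im, I_re, I_im]
    field_simp
    linear_combination h1 * (-1) + Real.sinh R ^ 2 * h2
  exact Real.cosh_strictMonoOn.injOn (Set.mem_Ici.2 dist_nonneg) (Set.mem_Ici.2 hR) h

/-- A hyperbolic circle is a Euclidean circle with another center, and the metric is conformal, so
the gradient of the distance to `I` points along the Euclidean normal `exp (t * I)`. -/
theorem pull_circle (R t : ℝ) (v : ℂ) : pull (circle R t) UpperHalfPlane.I v =
    Real.sinh R / (circle R t).im * (Complex.exp (-(t * Complex.I)) * v).re := by
  have hi := (circle R t).im_pos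
  rw [pull, ← neg_mul, ← Complex.ofReal_neg, Complex.mul_re, Complex.exp_ofReal_mul_I_re,
    Complex.exp_ofReal_mul_I_im, Real.cos_neg, Real.sin_neg]
  have h1 := Real.cosh_sq R
  have h2 := Real.sin_sq_add_cos_sq t
  rw [circle_im] at hi
  simp only [circle_re, circle_im, I_re, I_im]
  field_simp
  linear_combination v.im * h1 - v.im * Real.sinh R ^ 2 * h2

theorem IsLipschitzField.exists_zero {k : ℝ} (hk : k < 0) {Y : ℍ → ℂ} (hY : Continuous Y)
    (h : IsLipschitzField k Y) : ∃ z, Y z = 0 := by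
  by_contra! h0
  -- With this radius the rate is at most `-(‖Y I‖ + 1)`, while the end at `I` contributes at least
  -- `-‖Y I‖`; the end on the circle must then move inward.
  set R : ℝ := (‖Y UpperHalfPlane.I‖ + 1) / (-k) with hRdef
  have hR : 0 < R := div_pos (by positivity) (by linarith)
  have hkR : k * R = -(‖Y UpperHalfPlane.I‖ + 1) := by
    rw [hRdef]
    field_simp [hk.ne]
  have hcont : Continuous (circle R) := by
    rw [isEmbedding_coe.continuous_iff]
    change Continuous fun t : ℝ =>
      (Real.cosh R * Complex.I + Real.sinh R * Complex.exp (t * Complex.I) : ℂ)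
    fun_prop
  have hper : circle R (2 * Real.pi) = circle R 0 := by
    apply UpperHalfPlane.ext_re_im <;> simp [circle_re, circle_im]
  obtain ⟨t, ht⟩ := exists_re_exp_mul_nonneg hY h0 hcont hper
  have hd := dist_circle hR.le t
  have hne : circle R t ≠ UpperHalfPlane.I := dist_pos.1 (by rw [hd]; exact hR)
  have hi := (circle R t).im_pos
  have h1 := sinh_dist_mul_rate Y _ _ hne
  have h2 := h _ _ hne
  have h3 := (abs_le.1 (abs_pull_le UpperHalfPlane.I (circle R t) (Y UpperHalfPlane.I))).1
  rw [pull_circle, hd] at h1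
  rw [dist_comm, hd, I_im, div_one] at h3
  rw [hd, hkR] at h2
  have hs : 0 < Real.sinh R := Real.sinh_pos_iff.2 hR
  have h4 := mul_nonneg (div_pos hs hi).le ht
  have h5 := mul_le_mul_of_nonneg_left h2 hs.le
  linarith

/-! ### Properness and freeness of the action on the plane -/

open Matrix.SpecialLinearGroup in
theorem exists_mapGL_of_det_pos (g : GL (Fin 2) ℝ) (hg : 0 < g.1.det) :
    ∃ s : SL(2, ℝ), ProjGenLinGroup.mk (mapGL ℝ s) = ProjGenLinGroup.mk g := by
  have hr : √g.1.det ≠ 0 := (Real.sqrt_pos.2 hg).ne'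
  refine ⟨⟨(√g.1.det)⁻¹ • g.1, ?_⟩, ?_⟩
  · rw [Matrix.det_smul, Fintype.card_fin, inv_pow, Real.sq_sqrt hg.le, inv_mul_cancel₀ hg.ne']
  · rw [ProjGenLinGroup.mk_eq_mk_iff]
    refine ⟨Units.mk0 _ hr, Units.ext ?_⟩
    ext i j
    simp only [Units.val_mul, GeneralLinearGroup.coe_scalar, Units.val_mk0]
    rw [Matrix.scalar_apply, Matrix.mul_diagonal]
    change (√g.1.det)⁻¹ * g.1 i j * √g.1.det = g.1 i j
    field_simp

open Matrix.SpecialLinearGroup in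
-- `J` has determinant `-1`, so multiplying by it reduces negative determinant to positive, where
-- rescaling to determinant `1` is invisible in `PGL(2, ℝ)`.
theorem exists_mapGL (g : PGL(2, ℝ)) : ∃ s : SL(2, ℝ),
    ProjGenLinGroup.mk (mapGL ℝ s) = g ∨ ProjGenLinGroup.mk (UpperHalfPlane.J * mapGL ℝ s) = g := by
  induction g using ProjGenLinGroup.induction_on with
  | mk g =>
    rcases lt_or_gt_of_ne (show g.1.det ≠ 0 from g.det.ne_zero) with h | h
    · obtain ⟨s, hs⟩ := exists_mapGL_of_det_pos (UpperHalfPlane.J * g) (by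
        rw [Units.val_mul, Matrix.det_mul, val_J, Matrix.det_fin_two]
        simpa using h)
      refine ⟨s, Or.inr ?_⟩
      rw [map_mul, hs, ← map_mul, ← mul_assoc, ← pow_two, J_sq, one_mul]
    · obtain ⟨s, hs⟩ := exists_mapGL_of_det_pos g h
      exact ⟨s, Or.inl hs⟩

open Matrix.SpecialLinearGroup Pointwise in
/-- `PGL(2, ℝ)` acts properly: the elements moving `K` to meet `L` lift to a compact set. -/
theorem exists_isCompact_lifts {K L : Set ℍ} (hK : IsCompact K) (hL : IsCompact L) :
    ∃ C : Set (GL (Fin 2) ℝ), IsCompact C ∧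
      ∀ g : PGL(2, ℝ), ∀ z ∈ K, g • z ∈ L → ∃ h ∈ C, ProjGenLinGroup.mk h = g := by
  have hprop : ∀ {A B : Set ℍ}, IsCompact A → IsCompact B →
      IsCompact {s : SL(2, ℝ) | (s • A ∩ B).Nonempty} :=
    (MulAction.properSMul_iff_isCompact_setOfPred_inter_nonempty.1
      (inferInstance : ProperSMul SL(2, ℝ) ℍ))
  -- `J` is an involution, so `J s` moves a point into `L` exactly when `s` moves it into `J L`.
  have hJL : IsCompact ((fun z : ℍ => UpperHalfPlane.J • z) '' L) := hL.image (continuous_const_smul UpperHalfPlane.J)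
  refine ⟨mapGL ℝ '' {s : SL(2, ℝ) | (s • K ∩ L).Nonempty} ∪
    (fun s => UpperHalfPlane.J * mapGL ℝ s) '' {s : SL(2, ℝ) | (s • K ∩ (fun z : ℍ => UpperHalfPlane.J • z) '' L).Nonempty},
    ((hprop hK hL).image continuous_mapGL).union
      ((hprop hK hJL).image (continuous_const.mul continuous_mapGL)), fun g z hz hgz => ?_⟩
  obtain ⟨s, rfl | rfl⟩ := exists_mapGL g
  · exact ⟨_, Or.inl ⟨s, ⟨s • z, ⟨z, hz, rfl⟩, hgz⟩, rfl⟩, rfl⟩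
  · refine ⟨_, Or.inr ⟨s, ⟨s • z, ⟨z, hz, rfl⟩, _, hgz, ?_⟩, rfl⟩, rfl⟩
    change UpperHalfPlane.J • (UpperHalfPlane.J * mapGL ℝ s) • z = mapGL ℝ s • z
    rw [smul_smul, ← mul_assoc, ← pow_two, J_sq, one_mul]

section Discrete

variable {Γ : Type*} [Group Γ] {ρ₀ : Γ →* PGL(2, ℝ)}

theorem continuous_mk : Continuous (ProjGenLinGroup.mk : GL (Fin 2) ℝ → PGL(2, ℝ)) :=
  continuous_coinduced_rng

/-- A discretely embedded group meets the image of a compact set in a finite set. -/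
theorem IsDiscreteEmbedding.finite_of_isCompact (hρ₀ : IsDiscreteEmbedding ρ₀)
    {C : Set (GL (Fin 2) ℝ)} (hC : IsCompact C) :
    {γ : Γ | ∃ h ∈ C, ProjGenLinGroup.mk h = ρ₀ γ}.Finite := by
  obtain ⟨U, hU, hU1⟩ := isDiscrete_iff_forall_mem_exists_isOpen.1 hρ₀.2 1 (one_mem ρ₀.range)
  have h1U : (1 : PGL(2, ℝ)) ∈ U := (hU1.symm.subset rfl).1
  -- Neighborhoods so small that quotients of their elements land in `U`, where the image of `Γ` is
  -- trivial. Each then contains lifts of at most one `ρ₀ γ`.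
  have hN : ∀ h : GL (Fin 2) ℝ, ∃ N ∈ 𝓝 h, ∀ g ∈ N, ∀ g' ∈ N,
      ProjGenLinGroup.mk (g⁻¹ * g') ∈ U := fun h => by
    have hc : Continuous fun p : GL (Fin 2) ℝ × GL (Fin 2) ℝ =>
      (ProjGenLinGroup.mk (p.1⁻¹ * p.2) : PGL(2, ℝ)) := continuous_mk.comp (by fun_prop)
    have := hc.continuousAt.preimage_mem_nhds (x := (h, h))
      (hU.mem_nhds (by simpa using h1U))
    rw [nhds_prod_eq, Filter.mem_prod_same_iff] at this
    obtain ⟨N, hN, hsub⟩ := this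
    exact ⟨N, hN, fun g hg g' hg' => hsub (Set.mk_mem_prod hg hg')⟩
  choose N hN hNU using hN
  obtain ⟨t, -, ht⟩ := hC.elim_nhds_subcover N fun h _ => hN h
  refine (t.finite_toSet.biUnion (t := fun x => {γ : Γ | ∃ h ∈ N x, ProjGenLinGroup.mk h = ρ₀ γ})
    fun x _ => Set.Subsingleton.finite ?_).subset ?_
  · rintro γ ⟨g, hg, hgγ⟩ δ ⟨g', hg', hgδ⟩
    have h1 := hNU x g hg g' hg'
    rw [map_mul, map_inv, hgγ, hgδ, ← map_inv, ← map_mul] at h1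
    have h2 : ρ₀ (γ⁻¹ * δ) = 1 := hU1.subset ⟨h1, ⟨_, rfl⟩⟩
    exact inv_mul_eq_one.1 (hρ₀.1 (h2.trans (map_one ρ₀).symm))
  · rintro γ ⟨h, hh, hγ⟩
    obtain ⟨x, hx, hhx⟩ := Set.mem_iUnion₂.1 (ht hh)
    exact Set.mem_iUnion₂.2 ⟨x, hx, h, hhx, hγ⟩

theorem IsDiscreteEmbedding.properlyDiscontinuousSMul (hρ₀ : IsDiscreteEmbedding ρ₀) :
    ProperlyDiscontinuousSMul Γ (Hyp ρ₀) where
  finite_disjoint_inter_image {K L} hK hL := by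
    obtain ⟨C, hC, hCL⟩ := exists_isCompact_lifts (K := K) (L := L) hK hL
    refine (hρ₀.finite_of_isCompact hC).subset ?_
    rintro γ ⟨_, ⟨z, hz, rfl⟩, hzL⟩
    exact hCL (ρ₀ γ) z hz hzL

/-- A torsion-free properly discontinuous action is free. -/
theorem eq_one_of_smul_eq {T : Type*} [TopologicalSpace T] [MulAction Γ T]
    [ProperlyDiscontinuousSMul Γ T] (hΓ : ∀ γ : Γ, IsOfFinOrder γ → γ = 1) {γ : Γ} {x : T}
    (h : γ • x = x) : γ = 1 := by
  apply hΓ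
  have : Finite (MulAction.stabilizer Γ x) :=
    (ProperlyDiscontinuousSMul.finite_stabilizer x).to_subtype
  have := isOfFinOrder_of_finite (⟨γ, h⟩ : MulAction.stabilizer Γ x)
  exact (MulAction.stabilizer Γ x).subtype.isOfFinOrder this

instance : ContinuousConstSMul Γ (Hyp ρ₀) where
  continuous_const_smul γ := by
    change Continuous fun z : ℍ => ρ₀ γ • z
    obtain ⟨g, hg⟩ := ProjGenLinGroup.mk_surjective (ρ₀ γ)
    simp_rw [← hg, pglMk_smul]
    exact continuous_const_smul g

instance : T2Space (Hyp ρ₀) := inferInstanceAs (T2Space ℍ)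

instance : LocallyCompactSpace (Hyp ρ₀) := inferInstanceAs (LocallyCompactSpace ℍ)

end Discrete

/-! ### Affine line bundles and their quotients -/

section Bundles

variable {B E : Type*} [TopologicalSpace B] [TopologicalSpace E]

/-- A trivial line bundle, with the parametrizations that are affine in the trivialization. -/
theorem isAffineLineBundle_of_homeomorph {π : E → B} {L : Set (ℝ → E)} (Φ : E ≃ₜ B × ℝ)
    (hπ : ∀ P, (Φ P).1 = π P)
    (hL : ∀ c ∈ L, ∃ (z : B) (a d : ℝ), a ≠ 0 ∧ ∀ s, Φ (c s) = (z, a * s + d))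
    (hΦ : ∀ z, (fun s => Φ.symm (z, s)) ∈ L) : IsAffineLineBundle π L where
  injective c hc := by
    obtain ⟨z, a, d, ha, h⟩ := hL c hc
    intro s t hst
    have h1 : a * s + d = a * t + d := by
      have := (h s).symm.trans ((congrArg Φ hst).trans (h t))
      exact congrArg Prod.snd this
    exact mul_left_cancel₀ ha (add_right_cancel h1)
  range_eq c hc := by
    obtain ⟨z, a, d, ha, h⟩ := hL c hc
    have hz : ∀ s, π (c s) = z := fun s => by rw [← hπ, h]
    ext P
    constructor
    · rintro ⟨s, rfl⟩
      exact (hz s).trans (hz 0).symm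
    · intro hP
      refine ⟨((Φ P).2 - d) / a, Φ.injective ?_⟩
      rw [h]
      refine Prod.ext ?_ ?_
      · exact (((hπ P).trans hP).trans (hz 0)).symm
      · change a * (((Φ P).2 - d) / a) + d = (Φ P).2
        field_simp
        ring
  exists_line b := by
    refine ⟨_, hΦ b, ?_⟩
    ext P
    constructor
    · rintro ⟨s, rfl⟩
      change π (Φ.symm (b, s)) = b
      rw [← hπ, Φ.apply_symm_apply]
    · intro hP
      refine ⟨(Φ P).2, ?_⟩
      change Φ.symm (b, (Φ P).2) = P
      rw [Φ.symm_apply_eq, ← show π P = b from hP, ← hπ]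
  change c hc c' hc' hcc' := by
    obtain ⟨z, a, d, ha, h⟩ := hL c hc
    obtain ⟨z', a', d', ha', h'⟩ := hL c' hc'
    have hz : z = z' := by
      rw [← hπ, ← hπ, h, h'] at hcc'
      exact hcc'
    refine ⟨a' / a, (d' - d) / a, div_ne_zero ha' ha, fun s => Φ.injective ?_⟩
    rw [h, h', hz]
    refine Prod.ext rfl ?_
    change a' * s + d' = a * (a' / a * s + (d' - d) / a) + d
    field_simp
    ring
  trivialization b :=
    ⟨{ Φ.toOpenPartialHomeomorph with
        baseSet := Set.univ
        open_baseSet := isOpen_univ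
        source_eq := rfl
        target_eq := Set.univ_prod_univ.symm
        proj_toFun := fun P _ => hπ P }, Set.mem_univ b, fun c hc _ => by
      obtain ⟨z, a, d, ha, h⟩ := hL c hc
      exact ⟨a, d, ha, fun s => congrArg Prod.snd (h s)⟩⟩

variable {Γ : Type*} [Group Γ]

/-- The quotient map of a group action, restricted to an open set that meets none of its
translates. -/
def quotientChart [Nonempty E] [MulAction Γ E] [ContinuousConstSMul Γ E] (U : Set E)
    (hU : IsOpen U) (hfree : ∀ γ : Γ, ∀ x ∈ U, γ • x ∈ U → γ = 1) :
    OpenPartialHomeomorph E (Quotient (MulAction.orbitRel Γ E)) :=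
  OpenPartialHomeomorph.ofContinuousOpen
    (Set.InjOn.toPartialEquiv (Quotient.mk (MulAction.orbitRel Γ E)) U fun x hx y hy hxy => by
      obtain ⟨γ, hγ⟩ := MulAction.orbitRel_apply.1 (Quotient.exact hxy)
      have hγ' : γ • y = x := hγ
      have := hfree γ y hy (hγ' ▸ hx)
      rw [← hγ', this, one_smul])
    continuous_quot_mk.continuousOn isOpenMap_quotient_mk'_mul hU

variable [MulAction Γ E] [MulAction Γ B]

/-- The map of quotients induced by an equivariant map. -/
def quotientMap (π : E → B) (hπ : ∀ (γ : Γ) (P : E), π (γ • P) = γ • π P) :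
    Quotient (MulAction.orbitRel Γ E) → Quotient (MulAction.orbitRel Γ B) :=
  Quotient.map π fun P Q h => by
    obtain ⟨γ, hγ⟩ := MulAction.orbitRel_apply.1 h
    exact MulAction.orbitRel_apply.2 ⟨γ, ((hπ γ Q).symm.trans (congrArg π hγ))⟩

/-- Proper discontinuity pulls back along continuous equivariant maps. -/
theorem properlyDiscontinuousSMul_of_equivariant [ProperlyDiscontinuousSMul Γ B] {π : E → B}
    (hc : Continuous π) (hπ : ∀ (γ : Γ) (P : E), π (γ • P) = γ • π P) :
    ProperlyDiscontinuousSMul Γ E where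
  finite_disjoint_inter_image {K L} hK hL :=
    (ProperlyDiscontinuousSMul.finite_disjoint_inter_image (Γ := Γ) (hK.image hc)
      (hL.image hc)).subset (by
        rintro γ ⟨_, ⟨P, hP, rfl⟩, hPL⟩
        exact ⟨γ • π P, ⟨π P, ⟨P, hP, rfl⟩, rfl⟩, γ • P, hPL, hπ γ P⟩)

variable [ContinuousConstSMul Γ E] [ContinuousConstSMul Γ B]

/-- A trivialization over an open set that meets none of its translates descends to the
quotient. -/
def quotientTrivialization [Nonempty E] [Nonempty B] {F : Type*} [TopologicalSpace F] {π : E → B}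
    (hπ : ∀ (γ : Γ) (P : E), π (γ • P) = γ • π P) (e : Bundle.Trivialization F π)
    (hfree : ∀ γ : Γ, ∀ x ∈ e.baseSet, γ • x ∈ e.baseSet → γ = 1) :
    Bundle.Trivialization F (quotientMap (Γ := Γ) π hπ) where
  -- Lift to `e.source`, trivialize there, then project the base point. The source meets none of its
  -- translates because it lies over `e.baseSet`.
  toOpenPartialHomeomorph :=
    ((quotientChart e.source e.open_source fun γ P hP hγP => by
      rw [e.source_eq] at hP hγP
      exact hfree γ (π P) hP (hπ γ P ▸ hγP)).symm.trans' e.toOpenPartialHomeomorph rfl).trans'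
    ((quotientChart e.baseSet e.open_baseSet hfree).prod (OpenPartialHomeomorph.refl F))
    e.target_eq
  baseSet := Quotient.mk _ '' e.baseSet
  open_baseSet := isOpenMap_quotient_mk'_mul _ e.open_baseSet
  source_eq := by
    change Quotient.mk _ '' e.source = _
    rw [e.source_eq]
    ext Q
    constructor
    · rintro ⟨P, hP, rfl⟩
      exact ⟨π P, hP, rfl⟩
    · obtain ⟨P, rfl⟩ := Quotient.exists_rep Q
      rintro ⟨z, hz, hzP⟩
      obtain ⟨γ, hγ⟩ := MulAction.orbitRel_apply.1 (Quotient.exact hzP)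
      refine ⟨γ • P, ?_, Quotient.sound (MulAction.orbitRel_apply.2 ⟨γ, rfl⟩)⟩
      change π (γ • P) ∈ e.baseSet
      rw [hπ, show γ • π P = z from hγ]
      exact hz
  target_eq := rfl
  proj_toFun := by
    rintro _ ⟨P, hP, rfl⟩
    set s := quotientChart (Γ := Γ) e.source e.open_source (fun γ P hP hγP => by
      rw [e.source_eq] at hP hγP
      exact hfree γ (π P) hP (hπ γ P ▸ hγP)) with hs
    change Quotient.mk _ (e (s.symm (s P))).1 = Quotient.mk _ (π P)
    rw [s.left_inv hP, e.coe_fst hP]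

theorem quotientTrivialization_mk [Nonempty E] [Nonempty B] {F : Type*} [TopologicalSpace F]
    {π : E → B} (hπ : ∀ (γ : Γ) (P : E), π (γ • P) = γ • π P) (e : Bundle.Trivialization F π)
    (hfree : ∀ γ : Γ, ∀ x ∈ e.baseSet, γ • x ∈ e.baseSet → γ = 1) {P : E}
    (hP : π P ∈ e.baseSet) :
    (quotientTrivialization hπ e hfree (Quotient.mk _ P)).2 = (e P).2 := by
  set s := quotientChart (Γ := Γ) e.source e.open_source (fun γ P hP hγP => by
    rw [e.source_eq] at hP hγP
    exact hfree γ (π P) hP (hπ γ P ▸ hγP)) with hs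
  change (e (s.symm (s P))).2 = (e P).2
  rw [s.left_inv (e.mem_source.2 hP)]

/-- An equivariant affine line bundle descends to the quotient by a group that acts freely and
properly discontinuously on the base. -/
theorem IsAffineLineBundle.quotient [T2Space B] [LocallyCompactSpace B]
    [ProperlyDiscontinuousSMul Γ B] {π : E → B} {L : Set (ℝ → E)} (h : IsAffineLineBundle π L)
    (hπ : ∀ (γ : Γ) (P : E), π (γ • P) = γ • π P) (hL : ∀ γ : Γ, ∀ c ∈ L, (fun s => γ • c s) ∈ L)
    (hfree : ∀ (γ : Γ) (z : B), γ • z = z → γ = 1) :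
    IsAffineLineBundle (quotientMap (Γ := Γ) π hπ)
      ((fun (c : ℝ → E) (s : ℝ) => (Quotient.mk (MulAction.orbitRel Γ E) (c s))) '' L) := by
  have hfiber : ∀ c ∈ L, ∀ s, π (c s) = π (c 0) := fun c hc s =>
    (h.range_eq c hc).subset (Set.mem_range_self s)
  have hmove : ∀ (γ : Γ) (P : E),
      Quotient.mk (MulAction.orbitRel Γ E) (γ • P) = Quotient.mk _ P := fun γ P =>
    Quotient.sound (MulAction.orbitRel_apply.2 ⟨γ, rfl⟩)
  have hrange : ∀ (z : B) (c : ℝ → E), Set.range c = π ⁻¹' {z} →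
      Set.range (fun s => Quotient.mk (MulAction.orbitRel Γ E) (c s)) =
        quotientMap (Γ := Γ) π hπ ⁻¹' {Quotient.mk _ z} := by
    intro z c hc
    ext Q
    constructor
    · rintro ⟨s, rfl⟩
      exact congrArg (Quotient.mk _) (hc.subset (Set.mem_range_self s))
    · obtain ⟨P, rfl⟩ := Quotient.exists_rep Q
      intro hP
      obtain ⟨γ, hγ⟩ := MulAction.orbitRel_apply.1 (Quotient.exact (Eq.symm hP))
      have hγ' : π (γ • P) = z := (hπ γ P).trans hγ
      obtain ⟨s, hs⟩ := hc.symm.subset hγ'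
      exact ⟨s, (congrArg _ hs).trans (hmove γ P)⟩
  constructor
  · rintro _ ⟨c, hc, rfl⟩ s t hst
    obtain ⟨γ, hγ⟩ := MulAction.orbitRel_apply.1 (Quotient.exact hst)
    have hγ' : γ • c t = c s := hγ
    have h1 := congrArg π hγ'
    -- Both points lie in one fiber, so `γ` fixes its base point and freeness gives `γ = 1`.
    rw [hπ, hfiber c hc t, hfiber c hc s] at h1
    rw [hfree γ _ h1, one_smul] at hγ'
    exact h.injective c hc hγ'.symm
  · rintro _ ⟨c, hc, rfl⟩
    exact hrange _ c (h.range_eq c hc)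
  · intro b
    obtain ⟨z, rfl⟩ := Quotient.exists_rep b
    obtain ⟨c, hc, hcz⟩ := h.exists_line z
    exact ⟨_, ⟨c, hc, rfl⟩, hrange z c hcz⟩
  · rintro _ ⟨c, hc, rfl⟩ _ ⟨c', hc', rfl⟩ hcc'
    obtain ⟨γ, hγ⟩ := MulAction.orbitRel_apply.1 (Quotient.exact hcc')
    have hγ' : π (γ • c' 0) = π (c 0) := (hπ _ _).trans hγ
    obtain ⟨a, d, ha, had⟩ := h.change c hc _ (hL γ c' hc') hγ'.symm
    exact ⟨a, d, ha, fun s => (hmove γ (c' s)).symm.trans (congrArg _ (had s))⟩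
  · intro b
    obtain ⟨z, rfl⟩ := Quotient.exists_rep b
    obtain ⟨e, hze, he⟩ := h.trivialization z
    obtain ⟨c, hc, -⟩ := h.exists_line z
    have : Nonempty E := ⟨c 0⟩
    have : Nonempty B := ⟨z⟩
    -- Any `γ` for which `γ V` meets `V` fixes `z`, so by freeness a smaller open set `W` meets none
    -- of its nontrivial translates.
    obtain ⟨V, hV, hVfree⟩ := ProperlyDiscontinuousSMul.exists_nhds_image_smul_eq_self Γ z
    obtain ⟨W, hWV, hW, hzW⟩ := mem_nhds_iff.1 hV
    have hf : ∀ γ : Γ, ∀ x ∈ (e.restrOpen W hW).baseSet,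
        γ • x ∈ (e.restrOpen W hW).baseSet → γ = 1 := fun γ x hx hγx =>
      hfree γ z (hVfree γ ⟨γ • x, ⟨x, hWV hx.2, rfl⟩, hWV hγx.2⟩)
    refine ⟨quotientTrivialization hπ (e.restrOpen W hW) hf, ⟨z, ⟨hze, hzW⟩, rfl⟩, ?_⟩
    rintro _ ⟨c, hc, rfl⟩ ⟨y, hy, hyc⟩
    -- The representing line may lie over another sheet; a translate by `γ` lies over the base set
    -- and has the same image.
    obtain ⟨γ, hγ⟩ := MulAction.orbitRel_apply.1 (Quotient.exact hyc)
    have hγ' : π (γ • c 0) = y := (hπ _ _).trans hγ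
    have hmem : ∀ s, π (γ • c s) ∈ (e.restrOpen W hW).baseSet := fun s => by
      rw [hfiber _ (hL γ c hc) s, hγ']
      exact hy
    obtain ⟨a, d, ha, had⟩ := he _ (hL γ c hc) (hmem 0).1
    refine ⟨a, d, ha, fun s => ?_⟩
    change (quotientTrivialization hπ (e.restrOpen W hW) hf (Quotient.mk _ (c s))).2 = _
    rw [← hmove γ (c s), quotientTrivialization_mk _ _ _ (hmem s)]
    exact had s

end Bundles

/-! ### The affine action on `X - 𝔤` -/

variable {Γ : Type*} [Group Γ] {ρ₀ : Γ →* PGL(2, ℝ)} {u : Cocycle ρ₀}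

instance : T2Space (Coset u) := inferInstanceAs (T2Space LieAlg)

instance : LocallyCompactSpace (Coset u) :=
  LieAlg.coordsHomeomorph.isClosedEmbedding.locallyCompactSpace

instance : SecondCountableTopology (Coset u) :=
  LieAlg.coordsHomeomorph.isEmbedding.secondCountableTopology

theorem Coset.continuous_entry (i j : Fin 2) : Continuous fun P : Coset u => P.param.1 i j :=
  LieAlg.continuous_entry i j

theorem continuous_Ad (g : PGL(2, ℝ)) : Continuous (Ad g) := by
  induction g using ProjGenLinGroup.induction_on with
  | mk g =>
    refine Continuous.subtype_mk (f := fun A : LieAlg => g.1 * A.1 * (g⁻¹).1) ?_ _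
    exact (continuous_const.mul continuous_subtype_val).mul continuous_const

instance : ContinuousConstSMul Γ (Coset u) where
  continuous_const_smul γ := by
    change Continuous fun A : LieAlg => u.toFun γ + Ad (ρ₀ γ) A
    refine Continuous.subtype_mk (f := fun A : LieAlg => (u.toFun γ).1 + (Ad (ρ₀ γ) A).1) ?_ _
    exact continuous_const.add (continuous_subtype_val.comp (continuous_Ad _))

/-- The action of `γ` on `X - 𝔤` as an affine transformation. -/
def affineAction (γ : Γ) : Coset u ≃ᵃ[ℝ] Coset u :=
  AffineEquiv.ofBijective (φ :=
    { toFun := fun P => γ • P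
      linear := Ad (ρ₀ γ)
      map_vadd' := fun P v => by
        change u.toFun γ + Ad (ρ₀ γ) (v + P.param) =
          Ad (ρ₀ γ) v + (u.toFun γ + Ad (ρ₀ γ) P.param)
        rw [map_add]
        abel }) (MulAction.bijective γ)

theorem field_injective (X : ℍ → ℂ) : Function.Injective (Coset.field (u := u) X) :=
  fun _ _ h => killing_injective (sub_right_injective h)

theorem field_smul {X : ℍ → ℂ} (hX : IsEquivariantField u X) (γ : Γ) (P : Coset u) :
    (γ • P).field X = push (ρ₀ γ) (P.field X) := by
  change X - killing (u.toFun γ + Ad (ρ₀ γ) P.param) = push (ρ₀ γ) (X - killing P.param)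
  rw [killing_add, push_sub, push_killing, ← hX γ]
  abel

theorem continuous_field_apply (X : ℍ → ℂ) (z : ℍ) :
    Continuous fun P : Coset u => P.field X z := by
  have h := @Coset.continuous_entry Γ _ ρ₀ u
  change Continuous fun P : Coset u => X z - ((P.param.1 0 1 : ℂ) +
    ((P.param.1 0 0 : ℂ) - (P.param.1 1 1 : ℂ)) * z - (P.param.1 1 0 : ℂ) * (z : ℂ) ^ 2)
  have h' := fun i j => Complex.continuous_ofReal.comp (h i j)
  exact continuous_const.sub (((h' 0 1).add (((h' 0 0).sub (h' 1 1)).mul continuous_const)).sub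
    ((h' 1 0).mul continuous_const))

/-- The zero of `X - ξ` exists uniquely. -/
theorem exists_zeroMap {X : ℍ → ℂ} (hXcont : Continuous X) {k : ℝ} (hk : k < 0)
    (hX : IsLipschitzField k X) :
    ∃ ϖ : Coset u → Hyp ρ₀, ∀ (P : Coset u) (z : ℍ), P.field X z = 0 ↔ z = (ϖ P).pt := by
  have h : ∀ P : Coset u, ∃ z : ℍ, P.field X z = 0 := fun P =>
    (hX.sub_killing P.param).exists_zero hk (hXcont.sub (continuous_killing P.param))
  choose ϖ hϖ using h
  exact ⟨ϖ, fun P z => ⟨fun hz => (hX.sub_killing P.param).eq_of_zero hk hz (hϖ P),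
    fun hz => hz ▸ hϖ P⟩⟩

/-! ### The zero map as a bundle of timelike lines -/

section ZeroMap

variable {X : ℍ → ℂ} {ϖ : Coset u → Hyp ρ₀}
  (hϖ : ∀ (P : Coset u) (z : ℍ), P.field X z = 0 ↔ z = (ϖ P).pt)

include hϖ

theorem zeroMap_smul (hX : IsEquivariantField u X) (γ : Γ) (P : Coset u) :
    ϖ (γ • P) = γ • ϖ P := by
  refine ((hϖ (γ • P) (ρ₀ γ • (ϖ P).pt)).1 ?_).symm
  rw [field_smul hX]
  exact push_smul_eq_zero _ _ _ ((hϖ P _).2 rfl)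

/-- The contraction estimate for the field `Q`, taken at the point `ϖ P`, bounds `dist (ϖ Q) (ϖ P)`
by a continuous function of `Q` that vanishes at `P`. -/
theorem continuous_zeroMap {k : ℝ} (hk : k < 0) (hX : IsLipschitzField k X) : Continuous ϖ := by
  refine continuous_iff_continuousAt.2 fun P => ?_
  refine (tendsto_iff_dist_tendsto_zero (f := fun Q => (ϖ Q).pt) (a := (ϖ P).pt)).2 ?_
  have hlim : Filter.Tendsto (fun Q : Coset u => ‖Q.field X (ϖ P).pt‖ / (ϖ P).pt.im / -k)
      (𝓝 P) (𝓝 0) := by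
    have h := (((continuous_field_apply (u := u) X (ϖ P).pt).norm.div_const
      (ϖ P).pt.im).div_const (-k)).tendsto P
    rwa [(hϖ P _).2 rfl, norm_zero, zero_div, zero_div] at h
  refine squeeze_zero (fun Q => dist_nonneg) (fun Q => ?_) hlim
  rw [le_div_iff₀ (neg_pos.2 hk), mul_comm, dist_comm]
  exact (hX.sub_killing Q.param).mul_dist_le ((hϖ Q _).2 rfl)

/-- `killingLift` is one solution of "Killing value `X z` at `z`", and the others differ by
rotations about `z`. Lower left entries `0` and `1` make the coefficient readable from `P`. -/
theorem zeroMap_eq_iff (P : Coset u) (z : Hyp ρ₀) :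
    ϖ P = z ↔ P.param = killingLift z.pt (X z.pt) + P.param.1 1 0 • rotation z.pt := by
  have h1 : ϖ P = z ↔ killing (P.param - killingLift z.pt (X z.pt)) z.pt = 0 := by
    rw [killing_sub, Pi.sub_apply, killing_killingLift, ← neg_sub, neg_eq_zero]
    exact eq_comm.trans (hϖ P z.pt).symm
  have h2 : (P.param - killingLift z.pt (X z.pt)).1 1 0 = P.param.1 1 0 := by
    change P.param.1 1 0 - (killingLift z.pt (X z.pt)).1 1 0 = _
    simp [killingLift, LieAlg.of]
  rw [h1, killing_eq_zero_iff_smul_rotation, h2, sub_eq_iff_eq_add']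

/-- `ϖ`, together with the lower left entry, trivializes `X - 𝔤` as a line bundle. -/
def zeroChart (hXcont : Continuous X) (hc : Continuous ϖ) : Coset u ≃ₜ Hyp ρ₀ × ℝ where
  toFun P := (ϖ P, P.param.1 1 0)
  invFun p := (killingLift p.1.pt (X p.1.pt) + p.2 • rotation p.1.pt : LieAlg)
  left_inv P := ((zeroMap_eq_iff hϖ P (ϖ P)).1 rfl).symm
  right_inv p := by
    have h : (killingLift p.1.pt (X p.1.pt) + p.2 • rotation p.1.pt).1 1 0 = p.2 := by
      change (killingLift p.1.pt (X p.1.pt)).1 1 0 + p.2 * (rotation p.1.pt).1 1 0 = p.2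
      simp [killingLift, rotation, LieAlg.of]
    refine Prod.ext ((zeroMap_eq_iff hϖ _ p.1).2 ?_) h
    change _ = _ + (killingLift p.1.pt (X p.1.pt) + p.2 • rotation p.1.pt).1 1 0 • _
    rw [h]
    rfl
  continuous_toFun := hc.prodMk (Coset.continuous_entry 1 0)
  continuous_invFun := by
    have hz : Continuous fun p : Hyp ρ₀ × ℝ => p.1.pt := continuous_fst
    have hre := UpperHalfPlane.continuous_re.comp hz
    have him := UpperHalfPlane.continuous_im.comp hz
    have hv := hXcont.comp hz
    have hv1 := Complex.continuous_re.comp hv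
    have hv2 := Complex.continuous_im.comp hv
    have hne : ∀ p : Hyp ρ₀ × ℝ, p.1.pt.im ≠ 0 := fun p => p.1.pt.im_ne_zero
    refine LieAlg.coordsHomeomorph.isEmbedding.continuous_iff.2 (continuous_pi fun i => ?_)
    fin_cases i
    · change Continuous fun p : Hyp ρ₀ × ℝ =>
        (X p.1.pt).im / (2 * p.1.pt.im) + p.2 * p.1.pt.re
      exact (hv2.div (continuous_const.mul him) fun p => mul_ne_zero two_ne_zero (hne p)).add
        (continuous_snd.mul hre)
    · change Continuous fun p : Hyp ρ₀ × ℝ =>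
        ((X p.1.pt).re - (X p.1.pt).im / p.1.pt.im * p.1.pt.re) +
          p.2 * -(p.1.pt.re ^ 2 + p.1.pt.im ^ 2)
      exact (hv1.sub ((hv2.div him hne).mul hre)).add
        (continuous_snd.mul ((hre.pow 2).add (him.pow 2)).neg)
    · change Continuous fun p : Hyp ρ₀ × ℝ => (0 : ℝ) + p.2 * 1
      exact continuous_const.add (continuous_snd.mul continuous_const)

theorem zeroChart_symm_mem_fiberLines (hXcont : Continuous X) (hc : Continuous ϖ) (z : Hyp ρ₀) :
    (fun s => (zeroChart hϖ hXcont hc).symm (z, s)) ∈ fiberLines ϖ := by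
  have h : ∀ s, ϖ ((zeroChart hϖ hXcont hc).symm (z, s)) = z := fun s =>
    congrArg Prod.fst ((zeroChart hϖ hXcont hc).apply_symm_apply (z, s))
  have e : ∀ s, (zeroChart hϖ hXcont hc).symm (z, s) =
      (s • rotation z.pt) +ᵥ (zeroChart hϖ hXcont hc).symm (z, 0) := fun s => by
    change killingLift z.pt (X z.pt) + s • rotation z.pt =
      s • rotation z.pt + (killingLift z.pt (X z.pt) + (0 : ℝ) • rotation z.pt)
    rw [zero_smul, add_zero, add_comm]
  exact ⟨(zeroChart hϖ hXcont hc).symm (z, 0), rotation z.pt, timelike_rotation _, e,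
    fun s => (h s).trans (h 0).symm⟩

/-- The lower left entry is affine along the line, with slope that of `η`, nonzero since `η` is
timelike. -/
theorem zeroChart_fiberLine (hXcont : Continuous X) (hc : Continuous ϖ) {c : ℝ → Coset u}
    (hcL : c ∈ fiberLines ϖ) : ∃ (z : Hyp ρ₀) (a d : ℝ), a ≠ 0 ∧
      ∀ s, zeroChart hϖ hXcont hc (c s) = (z, a * s + d) := by
  obtain ⟨P, η, hη, hcs, hcz⟩ := hcL
  refine ⟨ϖ P, η.1 1 0, P.param.1 1 0, hη.ne_zero, fun s => Prod.ext (hcz s) ?_⟩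
  change (c s).param.1 1 0 = _
  rw [hcs]
  change s * η.1 1 0 + P.param.1 1 0 = _
  rw [mul_comm]

theorem isAffineLineBundle_zeroMap (hXcont : Continuous X) (hc : Continuous ϖ) :
    IsAffineLineBundle ϖ (fiberLines ϖ) :=
  isAffineLineBundle_of_homeomorph (zeroChart hϖ hXcont hc) (fun _ => rfl)
    (fun _ => zeroChart_fiberLine hϖ hXcont hc) (zeroChart_symm_mem_fiberLines hϖ hXcont hc)

end ZeroMap

/-! ### Descent to the quotient three-manifold -/

theorem smul_mem_fiberLines {ϖ : Coset u → Hyp ρ₀}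
    (hϖ : ∀ (γ : Γ) (P : Coset u), ϖ (γ • P) = γ • ϖ P) (γ : Γ) {c : ℝ → Coset u}
    (hc : c ∈ fiberLines ϖ) : (fun s => γ • c s) ∈ fiberLines ϖ := by
  obtain ⟨P, η, hη, hcs, hcz⟩ := hc
  refine ⟨γ • P, Ad (ρ₀ γ) η, ?_, fun s => ?_, fun s => ?_⟩
  · rw [Timelike, lorentz_Ad]
    exact hη
  · change γ • c s = _
    rw [hcs, ← map_smul]
    exact (affineAction (u := u) γ).map_vadd P (s • η)
  · change ϖ (γ • c s) = _
    rw [hϖ, hϖ, hcz]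

theorem isCompleteAffineThreeManifold [ProperlyDiscontinuousSMul Γ (Coset u)]
    (hfree : ∀ (γ : Γ) (P : Coset u), γ • P = P → γ = 1) :
    IsCompleteAffineThreeManifold LieAlg (fun P : Coset u => (⟦P⟧ : Spacetime u)) where
  finrank_eq := LieAlg.finrank_eq
  -- Orbits are separated because the action is properly discontinuous on a locally compact
  -- Hausdorff space.
  t2 := inferInstance
  secondCountable := ContinuousConstSMul.secondCountableTopology
  covering := by
    have : IsCancelSMul Γ (Coset u) := isCancelSMul_iff_eq_one_of_smul_eq.2 hfree
    exact (isQuotientCoveringMap_quotientMk_of_properlyDiscontinuousSMul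
      (G := Γ) (E := Coset u)).isCoveringMap
  surjective := Quotient.mk_surjective
  deck x y hxy := by
    obtain ⟨γ, hγ⟩ := MulAction.orbitRel_apply.1 (Quotient.exact hxy.symm)
    exact ⟨affineAction γ, hγ, fun z => Quotient.sound (MulAction.orbitRel_apply.2 ⟨γ, rfl⟩)⟩

end ContractingField

end

theorem mainTheorem4 {Γ : Type*} [Group Γ] (hΓ : ∀ γ : Γ, IsOfFinOrder γ → γ = 1)
    (ρ₀ : Γ →* PGL(2, ℝ)) (hρ₀ : ContractingField.IsDiscreteEmbedding ρ₀)
    (u : ContractingField.Cocycle ρ₀) (X : ℍ → ℂ) (hXcont : Continuous X)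
    (hXequiv : ContractingField.IsEquivariantField u X)
    (k : ℝ) (hk : k < 0) (hXlip : ContractingField.IsLipschitzField k X) :
    -- the points `X - ξ` are distinct vector fields, and the affine action of `Γ` is the action
    -- of `Γ` on vector fields through `ρ₀`
    Function.Injective (ContractingField.Coset.field (u := u) X) ∧
    (∀ (γ : Γ) (P : ContractingField.Coset u),
      (γ • P).field X = ContractingField.push (ρ₀ γ) (P.field X)) ∧
    ∃ ϖ : ContractingField.Coset u → ContractingField.Hyp ρ₀,
      -- `ϖ (X - ξ)` is the unique zero of `X - ξ`
      (∀ (P : ContractingField.Coset u) (z : ℍ), P.field X z = 0 ↔ z = (ϖ P).pt) ∧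
      -- `ϖ` is continuous and equivariant
      Continuous ϖ ∧
      (∀ (γ : Γ) (P : ContractingField.Coset u), ϖ (γ • P) = γ • ϖ P) ∧
      -- its fibers are timelike affine lines, and it is a fibration, indeed a bundle of such lines
      (∀ p : ContractingField.Hyp ρ₀, ∃ (P : ContractingField.Coset u)
        (η : ContractingField.LieAlg), ContractingField.Timelike η ∧
          ϖ ⁻¹' {p} = Set.range (fun s : ℝ => (s • η) +ᵥ P)) ∧
      ContractingField.IsAffineLineBundle ϖ (ContractingField.fiberLines ϖ) ∧
      -- the action is properly discontinuous and free; the quotient is a complete affine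
      -- three-manifold
      ProperlyDiscontinuousSMul Γ (ContractingField.Coset u) ∧
      (∀ (γ : Γ) (P : ContractingField.Coset u), γ • P = P → γ = 1) ∧
      ContractingField.IsCompleteAffineThreeManifold ContractingField.LieAlg
        (fun P : ContractingField.Coset u => (⟦P⟧ : ContractingField.Spacetime u)) ∧
      -- the map induced by `ϖ` on quotients is an affine line bundle over the surface
      ∃ q : ContractingField.Spacetime u → ContractingField.Surface ρ₀,
        (∀ P : ContractingField.Coset u, q ⟦P⟧ = ⟦ϖ P⟧) ∧
        ContractingField.IsAffineLineBundle q
          ((fun (c : ℝ → ContractingField.Coset u) (s : ℝ) =>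
            (⟦c s⟧ : ContractingField.Spacetime u)) '' ContractingField.fiberLines ϖ) := by
  open ContractingField in
  obtain ⟨ϖ, hϖ⟩ := exists_zeroMap (u := u) hXcont hk hXlip
  have hc := continuous_zeroMap hϖ hk hXlip
  have heq := zeroMap_smul hϖ hXequiv
  have := hρ₀.properlyDiscontinuousSMul
  have hpd : ProperlyDiscontinuousSMul Γ (Coset u) :=
    properlyDiscontinuousSMul_of_equivariant hc heq
  have hfree : ∀ (γ : Γ) (P : Coset u), γ • P = P → γ = 1 := fun γ P h => eq_one_of_smul_eq hΓ h
  have hbundle := isAffineLineBundle_zeroMap hϖ hXcont hc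
  refine ⟨field_injective X, field_smul hXequiv, ϖ, hϖ, hc, heq, fun p => ?_, hbundle, hpd, hfree,
    isCompleteAffineThreeManifold hfree, quotientMap ϖ heq, fun P => rfl,
    hbundle.quotient heq (fun γ c hcL => smul_mem_fiberLines heq γ hcL)
      fun γ z h => eq_one_of_smul_eq hΓ h⟩
  obtain ⟨c, ⟨P, η, hη, hcs, -⟩, hcp⟩ := hbundle.exists_line p
  exact ⟨P, η, hη, by rw [← hcp, funext hcs]⟩
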